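/- Let $M\in\mathbb{R}^{m\times n}$ be a nonzero matrix with spectral norm $\|M\|$, and let $f:\mathbb{R}^n\to{]-\infty,+\infty]}$ and $g:\mathbb{R}^m\to{]-\infty,+\infty]}$ be proper and lower semicontinuous. Let $\alpha,\beta\in\mathbb{R}$ with $\alpha\ge 0$ and $\alpha+\beta\|M\|^2\ge 0$, and suppose that $f-\frac{\alpha}{2}\|\cdot\|^2$ and $g-\frac{\beta}{2}\|\cdot\|^2$ are convex. Consider the problem $$(\mathcal P)\qquad \min\ f(x)+g(z)\quad\text{s.t. } Mx=z .$$ A triple $(x,z,y)\in\mathbb{R}^n\times\mathbb{R}^m\times\mathbb{R}^m$ is called a critical point of the Lagrangian $L_0(x,z,y)=f(x)+g(z)+\langle y,Mx-z\rangle$ if $-M^Ty\in\partial f(x)$, $y\in\widehat\partial g(z)$ and $Mx=z$, where $\partial$ is the convex and $\widehat\partial$ the Fréchet subdifferential. Suppose that $L_0$ has a critical point, and that either $f$ is strongly convex ($\alpha>0$) or $M^TM$ is invertible. Let $\delta>\max\{0,-2\beta\}$, $\Delta_\delta:=\frac{1}{\|M\|}\sqrt{2(\alpha+\beta\|M\|^2)(\delta+2\beta)}$,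 and let $\gamma>0$ satisfy $$\gamma=\delta+2\beta\ \text{ if } \alpha+\beta\|M\|^2=0,\qquad \max\{0,\delta+2\beta-\Delta_\delta\}<\gamma<\delta+2\beta+\Delta_\delta\ \text{ if } \alpha+\beta\|M\|^2>0 .$$ Then, for every initial point $(x^0,z^0,y^0)\in\mathbb{R}^n\times\mathbb{R}^m\times\mathbb{R}^m$, the adaptive ADMM $$x^{k+1}=\operatorname*{argmin}_{x\in\mathbb{R}^n}\Big\{f(x)+\tfrac{\gamma}{2}\big\|Mx-z^k+\tfrac{y^k}{\gamma}\big\|^2\Big\},$$ $$z^{k+1}=\operatorname*{argmin}_{z\in\mathbb{R}^m}\Big\{g(z)+\tfrac{\delta}{2}\big\|Mx^{k+1}-z+\tfrac{y^k}{\delta}\big\|^2\Big\},\qquad y^{k+1}=y^k+\delta(Mx^{k+1}-z^{k+1})$$ generates a well-defined, unique sequence $(x^k,z^k,y^k)_{k\ge0}$, and this sequence satisfies $$x^k\to x^\star,\qquad z^k\to z^\star,\qquad y^k\to y^\star,$$ where $(x^\star,z^\star,y^\star)$ is a critical point of $L_0$. Consequently, $(x^\star,z^\star)$ is a solution of $(\mathcal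 P)$. -/

import Mathlib

open Filter
open scoped Topology Matrix Matrix.Norms.L2Operator

namespace AADMM

section Functions

variable {E : Type*} [NormedAddCommGroup E] [InnerProductSpace ℝ E]

/-- `f : E → ]-∞, +∞]` with nonempty effective domain. -/
def IsProper (f : E → EReal) : Prop :=
  (∀ x, f x ≠ ⊥) ∧ ∃ x, f x ≠ ⊤

/-- `α`-convexity of `f : E → ]-∞, +∞]`, that is, convexity of `f - (α/2)‖·‖²`:
`f((1-t)x + ty) ≤ (1-t) f(x) + t f(y) - (α/2) t (1-t) ‖x - y‖²`. -/
def IsAlphaConvex (α : ℝ) (f : E → EReal) : Prop :=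
  ∀ x y : E, ∀ t : ℝ, 0 ≤ t → t ≤ 1 →
    f ((1 - t) • x + t • y) ≤
      ((1 - t : ℝ) : EReal) * f x + (t : EReal) * f y
        - ((α / 2 * t * (1 - t) * ‖x - y‖ ^ 2 : ℝ) : EReal)

/-- The convex subdifferential `∂f(x)`, empty outside the effective domain. -/
def subdiff (f : E → EReal) (x : E) : Set E :=
  {u | f x ≠ ⊤ ∧ ∀ y, ((inner ℝ (y - x) u : ℝ) : EReal) + f x ≤ f y}

/-- The Fréchet subdifferential of `f` at `x`, empty outside the effective domain. -/
def frechetSubdiff (f : E → EReal) (x : E) : Set E :=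
  {u | f x ≠ ⊤ ∧
    0 ≤ liminf
      (fun y => (f y - f x - ((inner ℝ u (y - x) : ℝ) : EReal)) / ((‖y - x‖ : ℝ) : EReal))
      (𝓝[≠] x)}

/-- `x` is a global minimizer of `φ`. -/
def IsArgmin (φ : E → EReal) (x : E) : Prop :=
  ∀ u, φ x ≤ φ u

end Functions

section Problem

variable {m n : ℕ}

/-- The matrix `M` as a map between Euclidean spaces. -/
noncomputable def act (M : Matrix (Fin m) (Fin n) ℝ) (x : EuclideanSpace ℝ (Fin n)) :
    EuclideanSpace ℝ (Fin m) :=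
  M.toEuclideanLin x

/-- `(x, z, y)` is a critical point of the Lagrangian
`L₀(x, z, y) = f(x) + g(z) + ⟨y, Mx - z⟩`. -/
def IsCriticalPoint (f : EuclideanSpace ℝ (Fin n) → EReal) (g : EuclideanSpace ℝ (Fin m) → EReal)
    (M : Matrix (Fin m) (Fin n) ℝ) (x : EuclideanSpace ℝ (Fin n))
    (z y : EuclideanSpace ℝ (Fin m)) : Prop :=
  -(act Mᵀ y) ∈ subdiff f x ∧ y ∈ frechetSubdiff g z ∧ act M x - z = 0

/-- `(x, z)` solves: minimize `f(x) + g(z)` subject to `Mx = z`. -/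
def IsSolution (f : EuclideanSpace ℝ (Fin n) → EReal) (g : EuclideanSpace ℝ (Fin m) → EReal)
    (M : Matrix (Fin m) (Fin n) ℝ) (x : EuclideanSpace ℝ (Fin n))
    (z : EuclideanSpace ℝ (Fin m)) : Prop :=
  act M x = z ∧ ∀ x' z', act M x' = z' → f x + g z ≤ f x' + g z'

/-- The sequence `s k = (xᵏ, zᵏ, yᵏ)` is generated by the adaptive ADMM with parameters `γ, δ`. -/
def IsAADMM (f : EuclideanSpace ℝ (Fin n) → EReal) (g : EuclideanSpace ℝ (Fin m) → EReal)
    (M : Matrix (Fin m) (Fin n) ℝ) (γ δ : ℝ)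
    (s : ℕ → EuclideanSpace ℝ (Fin n) × EuclideanSpace ℝ (Fin m) × EuclideanSpace ℝ (Fin m)) :
    Prop :=
  ∀ k,
    IsArgmin
      (fun x => f x + ((γ / 2 * ‖act M x - (s k).2.1 + γ⁻¹ • (s k).2.2‖ ^ 2 : ℝ) : EReal))
      (s (k + 1)).1 ∧
    IsArgmin
      (fun z => g z + ((δ / 2 * ‖act M (s (k + 1)).1 - z + δ⁻¹ • (s k).2.2‖ ^ 2 : ℝ) : EReal))
      (s (k + 1)).2.1 ∧
    (s (k + 1)).2.2 = (s k).2.2 + δ • (act M (s (k + 1)).1 - (s (k + 1)).2.1)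

end Problem

/-- `Δ_δ = ‖M‖⁻¹ √(2 (α + β‖M‖²)(δ + 2β))`, with `normM` the spectral norm of `M`. -/
noncomputable def paramRadius (α β normM δ : ℝ) : ℝ :=
  1 / normM * √(2 * (α + β * normM ^ 2) * (δ + 2 * β))

end AADMM

/-!
Critical points and iterates are both described by one relation between points and slopes:
`IsSubgradient c f x u` says that `f` lies above the parabola through `x` with slope `u` and
curvature `c`. For a `c`-convex function this is the Fréchet subdifferential, it is implied by
optimality in the subproblems, it is `c`-monotone, and for lower semicontinuous `f` its graph is
closed. The subproblems are strongly convex (by `α > 0` or injectivity of `M`, and by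
`δ + β > 0`), so each has exactly one minimizer and the algorithm is well defined.

Write `α' = α / ‖M‖²`, so that `x ↦ α‖x‖²` dominates `α'‖Mx‖²`. For a critical point
`(x⋆, z⋆, y⋆)`, monotonicity of the two subdifferentials shows (`fejer_step`) that the squared
distance from `w = y + δz` to `w⋆ = y⋆ + δz⋆` decreases in one step by at least
`δ [(2α' + 2γ - δ)‖u‖² - 2γ⟪u, v⟫ + (2β + δ)‖v‖²]`, where `u = Mx⁺ - z⋆` and `v = z - z⋆`. With
`c = δ + 2β`, the determinant of this form is `2(α' + β)c - (γ - c)²`, so the assumption on `γ` says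
that the form is positive definite, or equals `c‖u - v‖²` when `α' + β = 0`. In both cases it
dominates a positive multiple of `‖u - v‖² = ‖Mx⁺ - z‖²`
(`exists_pos_mul_norm_sub_sq_le`).

Hence `w` is Fejér monotone with respect to all critical points and `Mx⁺ - z → 0`. The iterates are
bounded; a cluster point is critical because the graphs are closed, and Fejér monotonicity with
respect to that cluster point makes the whole sequence converge
(`IsIteration.exists_tendsto`). A critical point is a solution since `α' + β ≥ 0` lets the
curvature of `f` compensate that of `g` along the constraint (`IsKKT.isSolution`).
-/

namespace AADMM

/-! ### Subgradients with quadratic growth -/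

section Subgradients

variable {E : Type*} [NormedAddCommGroup E] [InnerProductSpace ℝ E]

/-- `u` is a subgradient of `f` at `x` with quadratic growth of modulus `c`, that is,
`f y ≥ f x + ⟪u, y - x⟫ + (c/2)‖y - x‖²` for every `y`. The modulus may be negative. -/
def IsSubgradient (c : ℝ) (f : E → EReal) (x u : E) : Prop :=
  f x ≠ ⊤ ∧ ∀ y, f x + ((inner ℝ u (y - x) + c / 2 * ‖y - x‖ ^ 2 : ℝ) : EReal) ≤ f y

/-- For a `c`-convex function, first-order minorization along rays self-improves to a global
quadratic minorization. -/
theorem IsAlphaConvex.isSubgradient_of_eventually {c : ℝ} {f : E → EReal} {x u : E}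
    (hf : IsAlphaConvex c f) (hbot : ∀ y, f y ≠ ⊥) (hx : f x ≠ ⊤)
    (h : ∀ d : E, ∀ ε : ℝ, 0 < ε → ∀ᶠ t : ℝ in 𝓝[>] 0,
      f x + ((t * inner ℝ u d - ε * t : ℝ) : EReal) ≤ f (x + t • d)) :
    IsSubgradient c f x u := by
  refine ⟨hx, fun y => ?_⟩
  by_cases hy : f y = ⊤
  · rw [hy]; exact le_top
  obtain ⟨a, ha⟩ : ∃ a : ℝ, f x = a := ⟨_, (EReal.coe_toReal hx (hbot x)).symm⟩
  obtain ⟨b, hb⟩ : ∃ b : ℝ, f y = b := ⟨_, (EReal.coe_toReal hy (hbot y)).symm⟩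
  rw [ha, hb, ← EReal.coe_add, EReal.coe_le_coe_iff]
  have key : ∀ ε : ℝ, 0 < ε → inner ℝ u (y - x) - ε ≤ b - a - c / 2 * ‖y - x‖ ^ 2 := by
    intro ε hε
    have h1 : Tendsto (fun t : ℝ => b - a - c / 2 * (1 - t) * ‖y - x‖ ^ 2) (𝓝[>] 0)
        (𝓝 (b - a - c / 2 * (1 - 0) * ‖y - x‖ ^ 2)) :=
      (Continuous.tendsto (by fun_prop) 0).mono_left nhdsWithin_le_nhds
    simp only [sub_zero, mul_one] at h1
    refine ge_of_tendsto h1 ?_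
    filter_upwards [h (y - x) ε hε, Ioo_mem_nhdsGT (zero_lt_one' ℝ)] with t ht ht01
    have h2 := hf x y t ht01.1.le ht01.2.le
    rw [show (1 - t) • x + t • y = x + t • (y - x) by module] at h2
    have h3 := ht.trans h2
    rw [ha, hb] at h3
    norm_cast at h3
    rw [norm_sub_rev x y] at h3
    have ht0 := ht01.1
    nlinarith [h3]
  have := le_of_forall_pos_le_add (a := inner ℝ u (y - x)) (b := b - a - c / 2 * ‖y - x‖ ^ 2)
    (fun ε hε => by linarith [key ε hε])
  linarith

/-- Convexity up to a quadratic makes the local Fréchet condition a global one. -/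
theorem IsAlphaConvex.mem_frechetSubdiff_iff {c : ℝ} {f : E → EReal} {x u : E}
    (hf : IsAlphaConvex c f) (hbot : ∀ y, f y ≠ ⊥) :
    u ∈ frechetSubdiff f x ↔ IsSubgradient c f x u := by
  constructor
  · rintro ⟨hx, hlim⟩
    obtain ⟨a, ha⟩ : ∃ a : ℝ, f x = a := ⟨_, (EReal.coe_toReal hx (hbot x)).symm⟩
    refine hf.isSubgradient_of_eventually hbot hx fun d ε hε => ?_
    rcases eq_or_ne d 0 with rfl | hd
    · filter_upwards [self_mem_nhdsWithin] with t ht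
      rw [ha, smul_zero, add_zero, ha, inner_zero_right]
      norm_cast
      have := mul_pos hε (Set.mem_Ioi.1 ht)
      linarith
    have hd' : 0 < ‖d‖ := norm_pos_iff.2 hd
    have hlt : ((-(ε / ‖d‖) : ℝ) : EReal) < liminf
      (fun y => (f y - f x - ((inner ℝ u (y - x) : ℝ) : EReal)) / ((‖y - x‖ : ℝ) : EReal))
      (𝓝[≠] x) := by
      refine lt_of_lt_of_le ?_ hlim
      have : -(ε / ‖d‖) < 0 := by have := div_pos hε hd'; linarith
      exact_mod_cast this
    have hev := eventually_lt_of_lt_liminf hlt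
    have htend : Tendsto (fun t : ℝ => x + t • d) (𝓝[>] 0) (𝓝[≠] x) := by
      refine tendsto_nhdsWithin_iff.2 ⟨?_, ?_⟩
      · have : Tendsto (fun t : ℝ => x + t • d) (𝓝 0) (𝓝 (x + (0 : ℝ) • d)) :=
          Continuous.tendsto (by fun_prop) 0
        rw [zero_smul, add_zero] at this
        exact this.mono_left nhdsWithin_le_nhds
      · filter_upwards [self_mem_nhdsWithin] with t ht
        simp [hd, (Set.mem_Ioi.1 ht).ne']
    filter_upwards [htend.eventually hev, self_mem_nhdsWithin] with t ht ht0
    replace ht0 : 0 < t := ht0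
    by_cases hw : f (x + t • d) = ⊤
    · rw [hw]; exact le_top
    obtain ⟨b, hb⟩ : ∃ b : ℝ, f (x + t • d) = b := ⟨_, (EReal.coe_toReal hw (hbot _)).symm⟩
    rw [ha, hb, add_sub_cancel_left, ← EReal.coe_sub, ← EReal.coe_sub, ← EReal.coe_div,
      EReal.coe_lt_coe_iff, norm_smul, Real.norm_of_nonneg ht0.le, inner_smul_right,
      lt_div_iff₀ (by positivity)] at ht
    have h4 : -(ε / ‖d‖) * (t * ‖d‖) = -(ε * t) := by field_simp
    rw [h4] at ht
    rw [ha, hb]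
    norm_cast
    linarith
  · rintro ⟨hx, hmin⟩
    refine ⟨hx, ?_⟩
    obtain ⟨a, ha⟩ : ∃ a : ℝ, f x = a := ⟨_, (EReal.coe_toReal hx (hbot x)).symm⟩
    rcases (𝓝[≠] x).eq_or_neBot with hb | hb
    · rw [hb, liminf_bot]; exact le_top
    have h1 : Tendsto (fun y : E => ((c / 2 * ‖y - x‖ : ℝ) : EReal)) (𝓝[≠] x) (𝓝 0) := by
      have : Tendsto (fun y : E => c / 2 * ‖y - x‖) (𝓝 x) (𝓝 (c / 2 * ‖x - x‖)) :=
        Continuous.tendsto (by fun_prop) x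
      rw [sub_self, norm_zero, mul_zero] at this
      exact (continuous_coe_real_ereal.tendsto 0).comp (this.mono_left nhdsWithin_le_nhds)
    rw [← h1.liminf_eq]
    refine liminf_le_liminf ?_
    filter_upwards [self_mem_nhdsWithin] with y hy
    have hd : 0 < ‖y - x‖ := norm_pos_iff.2 (sub_ne_zero.2 hy)
    by_cases hw : f y = ⊤
    · rw [hw, ha, EReal.top_sub_coe, EReal.top_sub_coe,
        EReal.top_div_of_pos_ne_top (by exact_mod_cast hd) (EReal.coe_ne_top _)]
      exact le_top
    obtain ⟨b, hb⟩ : ∃ b : ℝ, f y = b := ⟨_, (EReal.coe_toReal hw (hbot _)).symm⟩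
    have h2 := hmin y
    rw [ha, hb] at h2 ⊢
    norm_cast at h2
    rw [← EReal.coe_sub, ← EReal.coe_sub, ← EReal.coe_div, EReal.coe_le_coe_iff,
      le_div_iff₀ hd]
    linarith

theorem IsAlphaConvex.mem_subdiff_iff {c : ℝ} (hc : 0 ≤ c) {f : E → EReal} {x u : E}
    (hf : IsAlphaConvex c f) (hbot : ∀ y, f y ≠ ⊥) :
    u ∈ subdiff f x ↔ IsSubgradient c f x u := by
  constructor
  · rintro ⟨hx, h⟩
    obtain ⟨a, ha⟩ : ∃ a : ℝ, f x = a := ⟨_, (EReal.coe_toReal hx (hbot x)).symm⟩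
    refine hf.isSubgradient_of_eventually hbot hx fun d ε hε => ?_
    filter_upwards [self_mem_nhdsWithin] with t ht
    refine le_trans ?_ (h (x + t • d))
    rw [ha, add_sub_cancel_left, inner_smul_left, real_inner_comm]
    norm_cast
    have := mul_pos hε (Set.mem_Ioi.1 ht)
    simp only [conj_trivial]
    linarith
  · rintro ⟨hx, h⟩
    refine ⟨hx, fun y => le_trans ?_ (h y)⟩
    rw [add_comm, real_inner_comm]
    gcongr
    norm_cast
    have : 0 ≤ c / 2 * ‖y - x‖ ^ 2 := by positivity
    linarith

/-- Subgradients of modulus `c` are `c`-monotone. -/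
theorem IsSubgradient.monotone {c : ℝ} {f : E → EReal} {x x' u u' : E} (hbot : ∀ y, f y ≠ ⊥)
    (h : IsSubgradient c f x u) (h' : IsSubgradient c f x' u') :
    c * ‖x - x'‖ ^ 2 ≤ inner ℝ (u - u') (x - x') := by
  obtain ⟨a, ha⟩ : ∃ a : ℝ, f x = a := ⟨_, (EReal.coe_toReal h.1 (hbot x)).symm⟩
  obtain ⟨b, hb⟩ : ∃ b : ℝ, f x' = b := ⟨_, (EReal.coe_toReal h'.1 (hbot _)).symm⟩
  have h1 := h.2 x'
  have h2 := h'.2 x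
  rw [ha, hb] at h1 h2
  norm_cast at h1 h2
  rw [norm_sub_rev x' x, ← neg_sub x x', inner_neg_right] at h1
  rw [inner_sub_left]
  linarith

/-- The graph of the subgradient relation of a lower semicontinuous function is closed. -/
theorem IsSubgradient.of_tendsto {ι : Type*} {l : Filter ι} [l.NeBot] {c : ℝ} {f : E → EReal}
    (hp : IsProper f) (hf : LowerSemicontinuous f) {x u : ι → E} {x' u' : E}
    (hx : Tendsto x l (𝓝 x')) (hu : Tendsto u l (𝓝 u'))
    (h : ∀ i, IsSubgradient c f (x i) (u i)) : IsSubgradient c f x' u' := by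
  have key : ∀ y (b : ℝ), f y = b →
      f x' ≤ ((b - (inner ℝ u' (y - x') + c / 2 * ‖y - x'‖ ^ 2) : ℝ) : EReal) := by
    intro y b hb
    have h1 : Tendsto (fun i => ((b - (inner ℝ (u i) (y - x i) + c / 2 * ‖y - x i‖ ^ 2) : ℝ)
        : EReal)) l (𝓝 ((b - (inner ℝ u' (y - x') + c / 2 * ‖y - x'‖ ^ 2) : ℝ) : EReal)) := by
      refine (continuous_coe_real_ereal.tendsto _).comp ?_
      have hd : Tendsto (fun i => y - x i) l (𝓝 (y - x')) := tendsto_const_nhds.sub hx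
      exact tendsto_const_nhds.sub ((hu.inner hd).add ((hd.norm.pow 2).const_mul _))
    refine le_of_forall_lt fun s hs => ?_
    obtain ⟨s', hs', hs''⟩ := exists_between hs
    refine hs'.trans_le (ge_of_tendsto h1 ?_)
    filter_upwards [hx.eventually (hf x' s' hs'')] with i hi
    refine hi.le.trans ?_
    have h2 := (h i).2 y
    obtain ⟨a, ha⟩ : ∃ a : ℝ, f (x i) = a :=
      ⟨_, (EReal.coe_toReal (h i).1 (hp.1 _)).symm⟩
    rw [ha, hb] at h2
    rw [ha]
    norm_cast at h2 ⊢
    linarith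
  have hx' : f x' ≠ ⊤ := by
    obtain ⟨y, hy⟩ := hp.2
    have := key y _ (EReal.coe_toReal hy (hp.1 y)).symm
    exact ne_top_of_le_ne_top (EReal.coe_ne_top _) this
  refine ⟨hx', fun y => ?_⟩
  by_cases hy : f y = ⊤
  · rw [hy]; exact le_top
  have h3 := key y _ (EReal.coe_toReal hy (hp.1 y)).symm
  rw [← EReal.coe_toReal hx' (hp.1 _)] at h3 ⊢
  rw [← EReal.coe_toReal hy (hp.1 y)]
  norm_cast at h3 ⊢
  linarith

end Subgradients

/-! ### Minimizers of strongly convex functions and optimality -/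

section Minimizers

variable {E : Type*} [NormedAddCommGroup E] [InnerProductSpace ℝ E]

theorem IsArgmin.unique {c : ℝ} (hc : 0 < c) {h : E → EReal} (hp : IsProper h)
    (hconv : IsAlphaConvex c h) {x y : E} (hx : IsArgmin h x) (hy : IsArgmin h y) : x = y := by
  obtain ⟨v, hv⟩ := hp.2
  obtain ⟨a, ha⟩ : ∃ a : ℝ, h x = a :=
    ⟨_, (EReal.coe_toReal (ne_top_of_le_ne_top hv (hx v)) (hp.1 x)).symm⟩
  have hb : h y = a := (le_antisymm (hy x) (hx y)).trans ha
  have h1 := (hx _).trans (hconv x y (1 / 2) (by norm_num) (by norm_num))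
  rw [ha, hb] at h1
  norm_cast at h1
  have h2 : ‖x - y‖ ^ 2 ≤ 0 := by
    by_contra hlt
    push Not at hlt
    nlinarith [mul_pos hc hlt]
  have h3 : ‖x - y‖ = 0 := by nlinarith [norm_nonneg (x - y)]
  exact sub_eq_zero.1 (norm_eq_zero.1 h3)

/-- A proper lower semicontinuous strongly convex function on a finite-dimensional space attains
its minimum: lower semicontinuity at one point of the domain bounds it below on a small ball, and
strong convexity propagates this to quadratic growth. -/
theorem exists_isArgmin [FiniteDimensional ℝ E] {c : ℝ} (hc : 0 < c) {h : E → EReal}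
    (hp : IsProper h) (hlsc : LowerSemicontinuous h) (hconv : IsAlphaConvex c h) :
    ∃ x, IsArgmin h x := by
  obtain ⟨x, hx⟩ := hp.2
  obtain ⟨a, ha⟩ : ∃ a : ℝ, h x = a := ⟨_, (EReal.coe_toReal hx (hp.1 x)).symm⟩
  have h1 : ∀ᶠ y in 𝓝 x, ((a - 1 : ℝ) : EReal) < h y := by
    have h2 : ((a - 1 : ℝ) : EReal) < h x := by
      rw [ha]
      norm_cast
      linarith
    exact hlsc x _ h2
  obtain ⟨r, hr, hball⟩ := Metric.nhds_basis_closedBall.eventually_iff.1 h1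
  set R : ℝ := 2 / (c * r) + r + 1 with hR
  have hcr : 0 < 2 / (c * r) := by positivity
  -- Outside the ball of radius `R` no value lies below the value at the centre.
  have hout : ∀ y, R < ‖y - x‖ → h x ≤ h y := by
    intro y hy
    by_cases hty : h y = ⊤
    · rw [hty]; exact le_top
    obtain ⟨b, hb⟩ : ∃ b : ℝ, h y = b := ⟨_, (EReal.coe_toReal hty (hp.1 y)).symm⟩
    set D := ‖y - x‖ with hD
    have hDpos : 0 < D := by linarith
    set t := r / D with ht
    have ht0 : 0 < t := by positivity
    have ht1 : t ≤ 1 := by rw [ht, div_le_one hDpos]; linarith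
    have htD : t * D = r := by rw [ht]; field_simp
    have hmem : x + t • (y - x) ∈ Metric.closedBall x r := by
      rw [mem_closedBall_iff_norm, add_sub_cancel_left, norm_smul, Real.norm_of_nonneg ht0.le,
        ← hD, htD]
    have h2 := hconv x y t ht0.le ht1
    rw [show (1 - t) • x + t • y = x + t • (y - x) by module] at h2
    have h3 := (hball hmem).le.trans h2
    rw [ha, hb] at h3
    norm_cast at h3
    rw [norm_sub_rev x y, ← hD] at h3
    rw [ha, hb]
    norm_cast
    have h4 : c / 2 * t * (1 - t) * D ^ 2 = c * r / 2 * (D - r) := by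
      rw [← htD]; ring
    have h5 : 1 ≤ c * r / 2 * (D - r) := by
      have h6 : 2 / (c * r) ≤ D - r := by linarith
      calc (1 : ℝ) = c * r / 2 * (2 / (c * r)) := by field_simp
        _ ≤ _ := by gcongr
    rw [h4] at h3
    have h7 : 0 ≤ t * (b - a) := by linarith
    have h8 := nonneg_of_mul_nonneg_right h7 ht0
    linarith
  have hRpos : 0 ≤ R := by positivity
  obtain ⟨w, hw, hmin⟩ := (hlsc.lowerSemicontinuousOn (Metric.closedBall x R)).exists_isMinOn
    ⟨x, Metric.mem_closedBall_self hRpos⟩ (isCompact_closedBall x R)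
  refine ⟨w, fun y => ?_⟩
  by_cases hy : ‖y - x‖ ≤ R
  · exact hmin (mem_closedBall_iff_norm.2 hy)
  · exact (hmin (Metric.mem_closedBall_self hRpos)).trans (hout y (not_le.1 hy))

variable {F : Type*} [NormedAddCommGroup F] [InnerProductSpace ℝ F]

theorem IsProper.add_real {X : Type*} {f : X → EReal} (hf : IsProper f) (q : X → ℝ) :
    IsProper (fun x => f x + (q x : EReal)) := by
  refine ⟨fun x => by simp [EReal.add_eq_bot_iff, hf.1 x], ?_⟩
  obtain ⟨x, hx⟩ := hf.2
  exact ⟨x, by simp [EReal.add_ne_top_iff_ne_top_left, hx]⟩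

theorem lowerSemicontinuous_add_real {X : Type*} [TopologicalSpace X] {f : X → EReal}
    (hf : LowerSemicontinuous f) {q : X → ℝ}
    (hq : Continuous q) : LowerSemicontinuous (fun x => f x + (q x : EReal)) := by
  refine hf.add' (continuous_coe_real_ereal.comp hq).lowerSemicontinuous fun x => ?_
  exact EReal.continuousAt_add (Or.inr (EReal.coe_ne_bot _)) (Or.inr (EReal.coe_ne_top _))

/-- Adding `(γ/2)‖A · + b‖²` raises the convexity modulus to any `κ` with
`κ‖d‖² ≤ c‖d‖² + γ‖A d‖²`. -/
theorem IsAlphaConvex.add_quadratic {c κ γ : ℝ} {f : E → EReal} (hp : IsProper f)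
    (hf : IsAlphaConvex c f) (A : E →ₗ[ℝ] F) (b : F)
    (hκ : ∀ d, κ * ‖d‖ ^ 2 ≤ c * ‖d‖ ^ 2 + γ * ‖A d‖ ^ 2) :
    IsAlphaConvex κ (fun x => f x + ((γ / 2 * ‖A x + b‖ ^ 2 : ℝ) : EReal)) := by
  intro x y t ht0 ht1
  rcases ht0.eq_or_lt with rfl | ht0
  · simp
  rcases ht1.eq_or_lt with rfl | ht1
  · simp
  have ht1' : 0 < 1 - t := by linarith
  by_cases hx : f x = ⊤
  · have h1 : ((1 - t : ℝ) : EReal) * (f x + ((γ / 2 * ‖A x + b‖ ^ 2 : ℝ) : EReal)) = ⊤ := by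
      rw [hx, EReal.top_add_coe, EReal.coe_mul_top_of_pos ht1']
    dsimp only
    rw [h1, EReal.top_add_of_ne_bot, EReal.top_sub_coe]
    · exact le_top
    · have := (hp.add_real (fun x => γ / 2 * ‖A x + b‖ ^ 2)).1 y
      by_cases hy : f y = ⊤
      · rw [hy, EReal.top_add_coe, EReal.coe_mul_top_of_pos ht0]; simp
      · rw [← EReal.coe_toReal hy (hp.1 y)]
        norm_cast
        exact EReal.coe_ne_bot _
  obtain ⟨r, hr⟩ : ∃ r : ℝ, f x = r := ⟨_, (EReal.coe_toReal hx (hp.1 x)).symm⟩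
  by_cases hy : f y = ⊤
  · dsimp only
    rw [hy, EReal.top_add_coe, EReal.coe_mul_top_of_pos ht0, hr]
    norm_cast
    rw [EReal.coe_add_top, EReal.top_sub_coe]
    exact le_top
  obtain ⟨s, hs⟩ : ∃ s : ℝ, f y = s := ⟨_, (EReal.coe_toReal hy (hp.1 y)).symm⟩
  have h1 := hf x y t ht0.le ht1.le
  rw [hr, hs] at h1
  norm_cast at h1
  have hz : f ((1 - t) • x + t • y) ≠ ⊤ := ne_top_of_le_ne_top (EReal.coe_ne_top _) h1
  obtain ⟨w, hw⟩ : ∃ w : ℝ, f ((1 - t) • x + t • y) = w :=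
    ⟨_, (EReal.coe_toReal hz (hp.1 _)).symm⟩
  dsimp only
  rw [hw] at h1 ⊢
  rw [hr, hs]
  norm_cast at h1 ⊢
  have h2 : A ((1 - t) • x + t • y) + b = (1 - t) • (A x + b) + t • (A y + b) := by
    rw [map_add, map_smul, map_smul]; module
  have h3 : ‖(1 - t) • (A x + b) + t • (A y + b)‖ ^ 2
      = (1 - t) * ‖A x + b‖ ^ 2 + t * ‖A y + b‖ ^ 2 - t * (1 - t) * ‖A (x - y)‖ ^ 2 := by
    have h5 : A (x - y) = (A x + b) - (A y + b) := by rw [map_sub]; abel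
    rw [h5, norm_add_sq_real, norm_sub_sq_real, norm_smul, norm_smul, inner_smul_left,
      inner_smul_right, Real.norm_of_nonneg ht0.le, Real.norm_of_nonneg ht1'.le]
    simp only [conj_trivial]
    ring
  have h4 := mul_le_mul_of_nonneg_left (hκ (x - y)) (mul_pos ht0 ht1').le
  rw [h2, h3]
  linarith

/-- Existence and uniqueness for the two subproblems of the algorithm. -/
theorem existsUnique_isArgmin_add_quadratic [FiniteDimensional ℝ E] {c κ γ : ℝ} {f : E → EReal}
    (hp : IsProper f) (hlsc : LowerSemicontinuous f) (hf : IsAlphaConvex c f) (A : E →L[ℝ] F)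
    (b : F) (hκ0 : 0 < κ) (hκ : ∀ d, κ * ‖d‖ ^ 2 ≤ c * ‖d‖ ^ 2 + γ * ‖A d‖ ^ 2) :
    ∃! x, IsArgmin (fun x => f x + ((γ / 2 * ‖A x + b‖ ^ 2 : ℝ) : EReal)) x := by
  have h1 := hf.add_quadratic hp A.toLinearMap b hκ
  have h2 := hp.add_real (fun x => γ / 2 * ‖A x + b‖ ^ 2)
  have h3 := lowerSemicontinuous_add_real (q := fun x => γ / 2 * ‖A x + b‖ ^ 2) hlsc
    (by fun_prop)
  obtain ⟨x, hx⟩ := exists_isArgmin hκ0 h2 h3 h1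
  exact ⟨x, hx, fun y hy => IsArgmin.unique hκ0 h2 h1 hy hx⟩

/-- First-order optimality condition for a `c`-convex function plus a quadratic term. -/
theorem IsArgmin.isSubgradient {c γ : ℝ} {f : E → EReal} (hp : IsProper f)
    (hf : IsAlphaConvex c f) {A : E →L[ℝ] F} {b : F} {x u : E}
    (hx : IsArgmin (fun x => f x + ((γ / 2 * ‖A x + b‖ ^ 2 : ℝ) : EReal)) x)
    (hu : ∀ d, inner ℝ u d = -(γ * inner ℝ (A x + b) (A d))) : IsSubgradient c f x u := by
  have hfx : f x ≠ ⊤ := by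
    obtain ⟨v, hv⟩ := hp.2
    intro hfx
    have h1 := hx v
    dsimp only at h1
    rw [hfx, EReal.top_add_coe, top_le_iff] at h1
    rw [← EReal.coe_toReal hv (hp.1 v)] at h1
    norm_cast at h1
    exact EReal.coe_ne_top _ h1
  refine hf.isSubgradient_of_eventually hp.1 hfx fun d ε hε => ?_
  obtain ⟨a, ha⟩ : ∃ a : ℝ, f x = a := ⟨_, (EReal.coe_toReal hfx (hp.1 x)).symm⟩
  have hsmall : ∀ᶠ t : ℝ in 𝓝[>] 0, t * (γ / 2 * ‖A d‖ ^ 2) < ε := by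
    have : Tendsto (fun t : ℝ => t * (γ / 2 * ‖A d‖ ^ 2)) (𝓝 0) (𝓝 (0 * (γ / 2 * ‖A d‖ ^ 2))) :=
      Continuous.tendsto (by fun_prop) 0
    rw [zero_mul] at this
    exact (this.mono_left nhdsWithin_le_nhds).eventually (gt_mem_nhds hε)
  filter_upwards [hsmall, self_mem_nhdsWithin] with t ht ht0
  replace ht0 : 0 < t := ht0
  by_cases hw : f (x + t • d) = ⊤
  · rw [hw]; exact le_top
  obtain ⟨s, hs⟩ : ∃ s : ℝ, f (x + t • d) = s := ⟨_, (EReal.coe_toReal hw (hp.1 _)).symm⟩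
  have h1 := hx (x + t • d)
  dsimp only at h1
  rw [ha, hs] at h1 ⊢
  norm_cast at h1 ⊢
  have h2 : A (x + t • d) + b = (A x + b) + t • A d := by rw [map_add, map_smul]; abel
  have h3 := norm_add_sq_real (A x + b) (t • A d)
  rw [norm_smul, inner_smul_right, Real.norm_of_nonneg ht0.le] at h3
  rw [h2, h3] at h1
  rw [hu]
  nlinarith [mul_lt_mul_of_pos_left ht ht0]

end Minimizers

/-! ### Fejér monotonicity and convergence -/

section Convergence

variable {E F : Type*} [NormedAddCommGroup E] [InnerProductSpace ℝ E]
  [NormedAddCommGroup F] [InnerProductSpace ℝ F]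

/-- One step of the algorithm, seen from a critical point `(xs, zs, ys)`: the squared distance from
`y + δz` to `ys + δzs` drops by `δ` times a quadratic form in `Ax⁺ - zs` and `z - zs`. -/
theorem fejer_step {A : E →L[ℝ] F} {xs x' : E} {zs ys z y : F} {α β α' γ δ ε : ℝ}
    (hδ : 0 < δ) (hα' : ∀ d, α' * ‖A d‖ ^ 2 ≤ α * ‖d‖ ^ 2)
    (hε : ∀ u v : F, ε * ‖u - v‖ ^ 2 ≤
      (2 * α' + 2 * γ - δ) * ‖u‖ ^ 2 - 2 * γ * inner ℝ u v + (2 * β + δ) * ‖v‖ ^ 2)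
    (hs : A xs = zs)
    (hf : α * ‖x' - xs‖ ^ 2 ≤ -inner ℝ (y - ys + γ • (A x' - z)) (A x' - zs))
    (hg : β * ‖z - zs‖ ^ 2 ≤ inner ℝ (y - ys) (z - zs)) :
    ‖y + δ • z + δ • (A x' - z) - (ys + δ • zs)‖ ^ 2 + δ * ε * ‖A x' - z‖ ^ 2 ≤
      ‖y + δ • z - (ys + δ • zs)‖ ^ 2 := by
  have h1 := (hα' (x' - xs)).trans hf
  rw [map_sub, hs] at h1
  obtain ⟨u, hu⟩ : ∃ u, u = A x' - zs := ⟨_, rfl⟩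
  obtain ⟨v, hv⟩ : ∃ v, v = z - zs := ⟨_, rfl⟩
  obtain ⟨p, hp⟩ : ∃ p, p = y - ys := ⟨_, rfl⟩
  have e1 : A x' - z = u - v := by rw [hu, hv]; abel
  have e2 : y + δ • z - (ys + δ • zs) = p + δ • v := by rw [hp, hv]; module
  have e3 : y + δ • z + δ • (A x' - z) - (ys + δ • zs) = p + δ • u := by
    rw [hp, hu]; module
  rw [← hu, e1, ← hp, inner_add_left, inner_smul_left, inner_sub_left] at h1
  rw [← hv, ← hp] at hg
  rw [e3, e2, e1]
  have h2 := mul_le_mul_of_nonneg_left (hε u v) hδ.le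
  rw [norm_add_sq_real, norm_add_sq_real, inner_smul_right, inner_smul_right, norm_smul,
    norm_smul, mul_pow, mul_pow, Real.norm_eq_abs, sq_abs]
  rw [real_inner_self_eq_norm_sq, real_inner_comm u v] at h1
  simp only [conj_trivial] at h1
  nlinarith [mul_le_mul_of_nonneg_left h1 hδ.le, mul_le_mul_of_nonneg_left hg hδ.le]

/-- The `z`-update is a Lipschitz function of `w = y + δz`. -/
theorem resolvent_bound {zs ys z y : F} {β δ : ℝ}
    (hg : β * ‖z - zs‖ ^ 2 ≤ inner ℝ (y - ys) (z - zs)) :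
    (δ + β) * ‖z - zs‖ ≤ ‖y + δ • z - (ys + δ • zs)‖ := by
  rcases (norm_nonneg (z - zs)).eq_or_lt with h0 | h0
  · rw [← h0, mul_zero]; exact norm_nonneg _
  have e : y + δ • z - (ys + δ • zs) = (y - ys) + δ • (z - zs) := by module
  have h1 := real_inner_le_norm (y + δ • z - (ys + δ • zs)) (z - zs)
  rw [e, inner_add_left, inner_smul_left, real_inner_self_eq_norm_sq] at h1
  simp only [conj_trivial] at h1
  rw [e]
  refine le_of_mul_le_mul_right ?_ h0
  nlinarith

/-- A positive definite form, or the degenerate form `γ‖u - v‖²`, dominates a positive multiple of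
`‖u - v‖²`. -/
theorem exists_pos_mul_norm_sub_sq_le {a c γ : ℝ} (hc : 0 < c)
    (h : γ ^ 2 < a * c ∨ (a = γ ∧ c = γ)) :
    ∃ ε : ℝ, 0 < ε ∧ ∀ u v : F,
      ε * ‖u - v‖ ^ 2 ≤ a * ‖u‖ ^ 2 - 2 * γ * inner ℝ u v + c * ‖v‖ ^ 2 := by
  rcases h with h | ⟨ha, hcγ⟩
  · have ha : 0 < a := by
      by_contra hna
      push Not at hna
      nlinarith [sq_nonneg γ, mul_nonneg (neg_nonneg.2 hna) hc.le]
    -- The smallest eigenvalue of `[[a, -γ], [-γ, c]]` is at least `det / trace`.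
    have hac : 0 < a + c := by positivity
    set η := (a * c - γ ^ 2) / (a + c) with hη
    have hη0 : 0 < η := div_pos (by linarith) hac
    have hηe : η * (a + c) = a * c - γ ^ 2 := by rw [hη]; field_simp
    refine ⟨η / 2, by positivity, fun u v => ?_⟩
    have h1 : ‖u - v‖ ^ 2 ≤ 2 * ‖u‖ ^ 2 + 2 * ‖v‖ ^ 2 := by
      have h2 := norm_add_sq_real u v
      have h3 := norm_sub_sq_real u v
      nlinarith [sq_nonneg ‖u + v‖]
    have h4 : η * (‖u‖ ^ 2 + ‖v‖ ^ 2) ≤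
        a * ‖u‖ ^ 2 - 2 * γ * inner ℝ u v + c * ‖v‖ ^ 2 := by
      have haη : 0 < a - η := by
        have : 0 < (a - η) * (a + c) := by nlinarith [sq_nonneg γ, mul_pos ha ha]
        exact pos_of_mul_pos_left this hac.le
      have h5 := sq_nonneg ‖(a - η) • u - γ • v‖
      rw [norm_sub_sq_real, inner_smul_left, inner_smul_right, norm_smul, norm_smul, mul_pow,
        mul_pow, Real.norm_eq_abs, Real.norm_eq_abs, sq_abs, sq_abs] at h5
      simp only [conj_trivial] at h5
      have h6 : 0 ≤ (a - η) * ((a - η) * ‖u‖ ^ 2 - 2 * γ * inner ℝ u v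
          + (c - η) * ‖v‖ ^ 2) := by
        have h7 : (a - η) * (c - η) = γ ^ 2 + η ^ 2 := by linear_combination -hηe
        nlinarith [mul_nonneg (sq_nonneg η) (sq_nonneg ‖v‖)]
      have h8 := nonneg_of_mul_nonneg_right h6 haη
      linarith
    nlinarith
  · refine ⟨γ, hcγ ▸ hc, fun u v => ?_⟩
    rw [norm_sub_sq_real, ha, hcγ]
    linarith

variable [CompleteSpace E] [CompleteSpace F]

/-- The optimality system `-A†y ∈ ∂f(x)`, `y ∈ ∂̂g(z)`, `Ax = z`, with the quadratic minorants that
`α`- and `β`-convexity provide. -/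
structure IsKKT (α β : ℝ) (f : E → EReal) (g : F → EReal) (A : E →L[ℝ] F) (x : E) (z y : F) :
    Prop where
  left : IsSubgradient α f x (-(A.adjoint y))
  right : IsSubgradient β g z y
  feasible : A x = z

/-- The iterates of the algorithm, described by the optimality conditions of the subproblems. -/
structure IsIteration (α β γ δ : ℝ) (f : E → EReal) (g : F → EReal) (A : E →L[ℝ] F)
    (x : ℕ → E) (z y : ℕ → F) : Prop where
  left : ∀ k, IsSubgradient α f (x (k + 1)) (-(A.adjoint (y k + γ • (A (x (k + 1)) - z k))))
  right : ∀ k, IsSubgradient β g (z (k + 1)) (y (k + 1))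
  dual : ∀ k, y (k + 1) = y k + δ • (A (x (k + 1)) - z (k + 1))

variable {α β γ δ : ℝ} {f : E → EReal} {g : F → EReal} {A : E →L[ℝ] F}
  {x : ℕ → E} {z y : ℕ → F} {xs : E} {zs ys : F}

theorem IsIteration.left_bound (hfb : ∀ v, f v ≠ ⊥) (h : IsIteration α β γ δ f g A x z y)
    (hs : IsKKT α β f g A xs zs ys) (k : ℕ) :
    α * ‖x (k + 1) - xs‖ ^ 2 ≤
      -inner ℝ (y k - ys + γ • (A (x (k + 1)) - z k)) (A (x (k + 1)) - zs) := by
  refine ((h.left k).monotone hfb hs.left).trans_eq ?_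
  rw [← hs.feasible, ← map_sub, ← ContinuousLinearMap.adjoint_inner_left, ← inner_neg_left]
  congr 1
  rw [neg_sub_neg, ← map_sub, ← map_neg]
  congr 1
  abel

theorem IsIteration.right_bound (hgb : ∀ v, g v ≠ ⊥) (h : IsIteration α β γ δ f g A x z y)
    (hs : IsKKT α β f g A xs zs ys) (k : ℕ) :
    β * ‖z (k + 1) - zs‖ ^ 2 ≤ inner ℝ (y (k + 1) - ys) (z (k + 1) - zs) :=
  (h.right k).monotone hgb hs.right

/-- Convergence of the iterates, by Opial's argument for `w k = y (k + 1) + δ z (k + 1)`. -/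
theorem IsIteration.exists_tendsto [FiniteDimensional ℝ E] [FiniteDimensional ℝ F]
    {α' ε κ : ℝ} (hf : IsProper f) (hfl : LowerSemicontinuous f) (hg : IsProper g)
    (hgl : LowerSemicontinuous g) (h : IsIteration α β γ δ f g A x z y)
    (hs : ∃ xs zs ys, IsKKT α β f g A xs zs ys) (hδ : 0 < δ) (hδβ : 0 < δ + β)
    (hα' : ∀ d, α' * ‖A d‖ ^ 2 ≤ α * ‖d‖ ^ 2) (hε0 : 0 < ε)
    (hε : ∀ u v : F, ε * ‖u - v‖ ^ 2 ≤
      (2 * α' + 2 * γ - δ) * ‖u‖ ^ 2 - 2 * γ * inner ℝ u v + (2 * β + δ) * ‖v‖ ^ 2)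
    (hκ0 : 0 < κ) (hκ : ∀ d, κ * ‖d‖ ^ 2 ≤ α * ‖d‖ ^ 2 + ‖A d‖ ^ 2) :
    ∃ xl zl yl, Tendsto x atTop (𝓝 xl) ∧ Tendsto z atTop (𝓝 zl) ∧ Tendsto y atTop (𝓝 yl) ∧
      IsKKT α β f g A xl zl yl := by
  -- Indices are shifted since `y 0` need not be a subgradient of `g` at `z 0`.
  set w : ℕ → F := fun k => y (k + 1) + δ • z (k + 1) with hw
  set r : ℕ → F := fun k => A (x (k + 2)) - z (k + 1) with hr
  have hyw : ∀ k, y (k + 1) = w k - δ • z (k + 1) := fun k => by simp [hw]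
  have hAx : ∀ k, A (x (k + 2)) = z (k + 1) + r k := fun k => by simp [hr]
  have hwr : ∀ k, w (k + 1) = w k + δ • r k := fun k => by
    simp only [hw, hr]
    rw [h.dual (k + 1)]
    module
  have hfejer : ∀ {xs zs ys}, IsKKT α β f g A xs zs ys → ∀ k,
      ‖w (k + 1) - (ys + δ • zs)‖ ^ 2 + δ * ε * ‖r k‖ ^ 2 ≤ ‖w k - (ys + δ • zs)‖ ^ 2 := by
    intro xs zs ys hs k
    rw [hwr]
    exact fejer_step hδ hα' hε hs.feasible (h.left_bound hf.1 hs (k + 1))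
      (h.right_bound hg.1 hs k)
  have hanti : ∀ {xs zs ys}, IsKKT α β f g A xs zs ys →
      Antitone fun k => ‖w k - (ys + δ • zs)‖ ^ 2 := by
    intro xs zs ys hs
    refine antitone_nat_of_succ_le fun k => ?_
    have h1 := hfejer hs k
    have h2 : 0 ≤ δ * ε * ‖r k‖ ^ 2 := by positivity
    linarith
  have hzw : ∀ {xs zs ys}, IsKKT α β f g A xs zs ys → ∀ k,
      ‖z (k + 1) - zs‖ ≤ (δ + β)⁻¹ * ‖w k - (ys + δ • zs)‖ := by
    intro xs zs ys hs k
    rw [← div_eq_inv_mul, le_div_iff₀' hδβ]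
    exact resolvent_bound (h.right_bound hg.1 hs k)
  have hxb : ∀ {xs zs ys}, IsKKT α β f g A xs zs ys → ∀ k, κ * ‖x (k + 2) - xs‖ ^ 2 ≤
      ‖y (k + 1) - ys + γ • r k‖ * ‖A (x (k + 2)) - zs‖ + ‖A (x (k + 2)) - zs‖ ^ 2 := by
    intro xs zs ys hs k
    have h1 := hκ (x (k + 2) - xs)
    rw [map_sub, hs.feasible] at h1
    have h2 := h.left_bound hf.1 hs (k + 1)
    have h3 := neg_le_of_abs_le (abs_real_inner_le_norm (y (k + 1) - ys + γ • r k)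
      (A (x (k + 2)) - zs))
    linarith
  obtain ⟨xs, zs, ys, hs⟩ := hs
  have hr0 : Tendsto r atTop (𝓝 0) := by
    obtain ⟨L, hL⟩ : ∃ L, Tendsto (fun k => ‖w k - (ys + δ • zs)‖ ^ 2) atTop (𝓝 L) :=
      ⟨_, tendsto_atTop_ciInf (hanti hs) ⟨0, by rintro _ ⟨k, rfl⟩; positivity⟩⟩
    have h1 := (hL.sub ((tendsto_add_atTop_iff_nat 1).2 hL)).const_mul (δ * ε)⁻¹
    rw [sub_self, mul_zero] at h1
    have h2 : Tendsto (fun k => ‖r k‖ ^ 2) atTop (𝓝 0) := by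
      refine squeeze_zero (fun k => by positivity) (fun k => ?_) h1
      rw [← div_eq_inv_mul, le_div_iff₀' (by positivity)]
      linarith [hfejer hs k]
    have h3 := h2.sqrt
    simp only [Real.sqrt_zero, Real.sqrt_sq (norm_nonneg _)] at h3
    exact tendsto_zero_iff_norm_tendsto_zero.2 h3
  -- All iterates are bounded, hence cluster.
  obtain ⟨W, hW⟩ : ∃ W, ∀ k, ‖w k - (ys + δ • zs)‖ ≤ W :=
    ⟨‖w 0 - (ys + δ • zs)‖, fun k =>
      (sq_le_sq₀ (norm_nonneg _) (norm_nonneg _)).1 (hanti hs (Nat.zero_le k))⟩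
  obtain ⟨Z, hZ⟩ : ∃ Z, ∀ k, ‖z (k + 1) - zs‖ ≤ Z :=
    ⟨(δ + β)⁻¹ * W, fun k => (hzw hs k).trans (by gcongr; exact hW k)⟩
  obtain ⟨R, hR⟩ : ∃ R, ∀ k, ‖r k‖ ≤ R := by
    obtain ⟨R, hR⟩ := hr0.norm.bddAbove_range
    exact ⟨R, fun k => hR ⟨k, rfl⟩⟩
  obtain ⟨X, hX⟩ : ∃ X, ∀ k, ‖x (k + 2) - xs‖ ≤ X := by
    have hZ0 : 0 ≤ Z := (norm_nonneg _).trans (hZ 0)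
    have hR0 : 0 ≤ R := (norm_nonneg _).trans (hR 0)
    have hW0 : 0 ≤ W := (norm_nonneg _).trans (hW 0)
    refine ⟨√(κ⁻¹ * ((W + δ * Z + |γ| * R) * (Z + R) + (Z + R) ^ 2)), fun k => ?_⟩
    refine Real.le_sqrt_of_sq_le ?_
    rw [← div_eq_inv_mul, le_div_iff₀' hκ0]
    refine (hxb hs k).trans ?_
    have h1 : ‖A (x (k + 2)) - zs‖ ≤ Z + R := by
      rw [hAx, add_sub_right_comm]
      exact (norm_add_le _ _).trans (add_le_add (hZ k) (hR k))
    have h2 : ‖y (k + 1) - ys + γ • r k‖ ≤ W + δ * Z + |γ| * R := by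
      have e : y (k + 1) - ys = (w k - (ys + δ • zs)) - δ • (z (k + 1) - zs) := by
        rw [hyw]; module
      refine (norm_add_le _ _).trans (add_le_add ?_ ?_)
      · rw [e]
        refine (norm_sub_le _ _).trans (add_le_add (hW k) ?_)
        rw [norm_smul, Real.norm_of_nonneg hδ.le]
        exact mul_le_mul_of_nonneg_left (hZ k) hδ.le
      · rw [norm_smul, Real.norm_eq_abs]
        exact mul_le_mul_of_nonneg_left (hR k) (abs_nonneg _)
    gcongr
  have hmem : ∀ k, (x (k + 2), z (k + 1), w k) ∈
      Metric.closedBall xs X ×ˢ Metric.closedBall zs Z ×ˢ Metric.closedBall (ys + δ • zs) W :=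
    fun k => ⟨mem_closedBall_iff_norm.2 (hX k), mem_closedBall_iff_norm.2 (hZ k),
      mem_closedBall_iff_norm.2 (hW k)⟩
  obtain ⟨⟨xl, zl, wl⟩, -, φ, hφ, hlim⟩ := tendsto_subseq_of_bounded
    (Metric.isBounded_closedBall.prod
      (Metric.isBounded_closedBall.prod Metric.isBounded_closedBall)) hmem
  have hxφ : Tendsto (fun j => x (φ j + 2)) atTop (𝓝 xl) := hlim.fst_nhds
  have hzφ : Tendsto (fun j => z (φ j + 1)) atTop (𝓝 zl) := hlim.snd_nhds.fst_nhds
  have hwφ : Tendsto (fun j => w (φ j)) atTop (𝓝 wl) := hlim.snd_nhds.snd_nhds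
  have hrφ : Tendsto (fun j => r (φ j)) atTop (𝓝 0) := hr0.comp hφ.tendsto_atTop
  obtain ⟨yl, hyl⟩ : ∃ yl, yl = wl - δ • zl := ⟨_, rfl⟩
  have hyφ : Tendsto (fun j => y (φ j + 1)) atTop (𝓝 yl) := by
    simp only [hyw]
    rw [hyl]
    exact hwφ.sub (hzφ.const_smul δ)
  -- The cluster point is critical because the subgradient graphs are closed.
  have hl : IsKKT α β f g A xl zl yl := by
    refine ⟨?_, ?_, ?_⟩
    · refine IsSubgradient.of_tendsto hf hfl hxφ ?_ fun j => h.left (φ j + 1)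
      have h1 : Tendsto (fun j => y (φ j + 1) + γ • r (φ j)) atTop (𝓝 (yl + γ • 0)) :=
        hyφ.add (hrφ.const_smul γ)
      rw [smul_zero, add_zero] at h1
      exact ((A.adjoint.continuous.tendsto yl).comp h1).neg
    · exact IsSubgradient.of_tendsto hg hgl hzφ hyφ fun j => h.right (φ j)
    · have h1 : Tendsto (fun j => A (x (φ j + 2))) atTop (𝓝 (A xl)) :=
        (A.continuous.tendsto xl).comp hxφ
      have h2 := hzφ.add hrφ
      simp only [hAx] at h1
      rw [add_zero] at h2
      exact tendsto_nhds_unique h1 h2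
  have hwl : yl + δ • zl = wl := by rw [hyl]; abel
  have hw0 : Tendsto (fun k => ‖w k - (yl + δ • zl)‖) atTop (𝓝 0) := by
    have h1 := tendsto_atTop_ciInf (hanti hl) ⟨0, by rintro _ ⟨k, rfl⟩; positivity⟩
    have h2 : Tendsto (fun j => ‖w (φ j) - (yl + δ • zl)‖ ^ 2) atTop (𝓝 0) := by
      have := ((hwφ.sub_const wl).norm).pow 2
      simpa [hwl] using this
    rw [tendsto_nhds_unique (h1.comp hφ.tendsto_atTop) h2] at h1
    have h3 := h1.sqrt
    simpa only [Real.sqrt_zero, Real.sqrt_sq (norm_nonneg _)] using h3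
  have hwt : Tendsto w atTop (𝓝 (yl + δ • zl)) := tendsto_iff_norm_sub_tendsto_zero.2 hw0
  have hzt : Tendsto (fun k => z (k + 1)) atTop (𝓝 zl) := by
    refine tendsto_iff_norm_sub_tendsto_zero.2
      (squeeze_zero (fun k => norm_nonneg _) (hzw hl) ?_)
    simpa using hw0.const_mul (δ + β)⁻¹
  have hyt : Tendsto (fun k => y (k + 1)) atTop (𝓝 yl) := by
    simp only [hyw]
    have := hwt.sub (hzt.const_smul δ)
    rwa [add_sub_cancel_right] at this
  have hAt : Tendsto (fun k => ‖A (x (k + 2)) - zl‖) atTop (𝓝 0) := by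
    simp only [hAx]
    have := ((hzt.add hr0).sub_const zl).norm
    simpa using this
  have hxt : Tendsto (fun k => x (k + 2)) atTop (𝓝 xl) := by
    have h1 : Tendsto (fun k => ‖y (k + 1) - yl + γ • r k‖) atTop (𝓝 0) := by
      have := ((hyt.sub_const yl).add (hr0.const_smul γ)).norm
      simpa using this
    have h2 := ((h1.mul hAt).add (hAt.pow 2)).const_mul κ⁻¹
    have h3 : Tendsto (fun k => ‖x (k + 2) - xl‖ ^ 2) atTop (𝓝 0) := by
      refine squeeze_zero (fun k => by positivity) (fun k => ?_) (by simpa using h2)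
      rw [← div_eq_inv_mul, le_div_iff₀' hκ0]
      exact hxb hl k
    have h4 := h3.sqrt
    simp only [Real.sqrt_zero, Real.sqrt_sq (norm_nonneg _)] at h4
    exact tendsto_iff_norm_sub_tendsto_zero.2 h4
  exact ⟨xl, zl, yl, (tendsto_add_atTop_iff_nat 2).1 hxt, (tendsto_add_atTop_iff_nat 1).1 hzt,
    (tendsto_add_atTop_iff_nat 1).1 hyt, hl⟩

end Convergence

/-! ### The matrix problem -/

section Problem

variable {m n : ℕ}

/-- The matrix `M` as a continuous linear map; its operator norm is the spectral norm of `M`. -/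
noncomputable def actCLM (M : Matrix (Fin m) (Fin n) ℝ) :
    EuclideanSpace ℝ (Fin n) →L[ℝ] EuclideanSpace ℝ (Fin m) :=
  LinearMap.toContinuousLinearMap M.toEuclideanLin

theorem act_transpose (M : Matrix (Fin m) (Fin n) ℝ) (y : EuclideanSpace ℝ (Fin m)) :
    act Mᵀ y = (actCLM M).adjoint y := by
  rw [act, ← Matrix.conjTranspose_eq_transpose_of_trivial,
    Matrix.toEuclideanLin_conjTranspose_eq_adjoint]
  rfl

theorem norm_act_le (M : Matrix (Fin m) (Fin n) ℝ) (x : EuclideanSpace ℝ (Fin n)) :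
    ‖actCLM M x‖ ≤ ‖M‖ * ‖x‖ :=
  (actCLM M).le_opNorm x

theorem act_injective {M : Matrix (Fin m) (Fin n) ℝ} (h : IsUnit (Mᵀ * M)) :
    Function.Injective (actCLM M) := by
  refine (injective_iff_map_eq_zero (actCLM M)).2 fun x hx => ?_
  have h1 : M *ᵥ x.ofLp = 0 := congrArg WithLp.ofLp hx
  have h2 : (Mᵀ * M) *ᵥ x.ofLp = (Mᵀ * M) *ᵥ 0 := by
    rw [← Matrix.mulVec_mulVec, h1, Matrix.mulVec_zero, Matrix.mulVec_zero]
  exact WithLp.ofLp_injective 2 (Matrix.mulVec_injective_of_isUnit h h2)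

/-- Either alternative makes `α‖·‖² + ‖M·‖²` positive definite. -/
theorem exists_pos_mul_norm_sq_le {M : Matrix (Fin m) (Fin n) ℝ} {α : ℝ} (hα : 0 ≤ α)
    (h : 0 < α ∨ IsUnit (Mᵀ * M)) :
    ∃ κ : ℝ, 0 < κ ∧ ∀ d, κ * ‖d‖ ^ 2 ≤ α * ‖d‖ ^ 2 + ‖actCLM M d‖ ^ 2 := by
  rcases h with h | h
  · exact ⟨α, h, fun d => le_add_of_nonneg_right (by positivity)⟩
  · obtain ⟨K, hK, hA⟩ := (LinearMap.injective_iff_antilipschitz (actCLM M).toLinearMap).1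
      (act_injective h)
    have hK' : (0 : ℝ) < K := by exact_mod_cast hK
    refine ⟨(K ^ 2 : ℝ)⁻¹, by positivity, fun d => ?_⟩
    have h1 : ‖d‖ ≤ K * ‖actCLM M d‖ := by simpa using hA.le_mul_dist d 0
    have h2 : (K ^ 2 : ℝ)⁻¹ * ‖d‖ ^ 2 ≤ ‖actCLM M d‖ ^ 2 := by
      rw [inv_mul_le_iff₀ (by positivity), ← mul_pow]
      gcongr
    have h3 : 0 ≤ α * ‖d‖ ^ 2 := by positivity
    linarith

variable {f : EuclideanSpace ℝ (Fin n) → EReal} {g : EuclideanSpace ℝ (Fin m) → EReal}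
  {M : Matrix (Fin m) (Fin n) ℝ} {α β γ δ : ℝ}

theorem isCriticalPoint_iff_isKKT (hf : IsProper f) (hfc : IsAlphaConvex α f) (hα : 0 ≤ α)
    (hg : IsProper g) (hgc : IsAlphaConvex β g) {x : EuclideanSpace ℝ (Fin n)}
    {z y : EuclideanSpace ℝ (Fin m)} :
    IsCriticalPoint f g M x z y ↔ IsKKT α β f g (actCLM M) x z y := by
  rw [IsCriticalPoint, act_transpose, hfc.mem_subdiff_iff hα hf.1,
    hgc.mem_frechetSubdiff_iff hg.1, sub_eq_zero]
  exact ⟨fun h => ⟨h.1, h.2.1, h.2.2⟩, fun h => ⟨h.1, h.2, h.3⟩⟩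

/-- A possibly negative curvature of `g` is compensated by that of `f` on the feasible set. -/
theorem IsKKT.isSolution (hf : IsProper f) (hg : IsProper g) {α' : ℝ}
    (hα' : ∀ d, α' * ‖actCLM M d‖ ^ 2 ≤ α * ‖d‖ ^ 2) (hαβ : 0 ≤ α' + β)
    {x : EuclideanSpace ℝ (Fin n)} {z y : EuclideanSpace ℝ (Fin m)}
    (h : IsKKT α β f g (actCLM M) x z y) : IsSolution f g M x z := by
  refine ⟨h.feasible, fun x' z' hz' => ?_⟩
  by_cases hx : f x' = ⊤
  · rw [hx, EReal.top_add_of_ne_bot (hg.1 _)]; exact le_top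
  by_cases hz : g z' = ⊤
  · rw [hz, EReal.add_top_of_ne_bot (hf.1 _)]; exact le_top
  have h1 := h.left.2 x'
  have h2 := h.right.2 z'
  rw [← EReal.coe_toReal hx (hf.1 _), ← EReal.coe_toReal h.left.1 (hf.1 _)] at h1 ⊢
  rw [← EReal.coe_toReal hz (hg.1 _), ← EReal.coe_toReal h.right.1 (hg.1 _)] at h2 ⊢
  norm_cast at h1 h2 ⊢
  have hd : z' - z = actCLM M (x' - x) := by rw [map_sub, h.feasible, ← hz']; rfl
  rw [inner_neg_left, ContinuousLinearMap.adjoint_inner_left, ← hd] at h1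
  have h3 := hα' (x' - x)
  rw [← hd] at h3
  have h4 : 0 ≤ (α' + β) * ‖z' - z‖ ^ 2 := by positivity
  linarith

/-- The first-order conditions of the two subproblems, with slopes written through the multiplier;
for the `z`-update the slope is exactly the new multiplier. -/
theorem IsAADMM.isIteration (hf : IsProper f) (hfc : IsAlphaConvex α f) (hg : IsProper g)
    (hgc : IsAlphaConvex β g) (hγ : γ ≠ 0) (hδ : δ ≠ 0)
    {s : ℕ → EuclideanSpace ℝ (Fin n) × EuclideanSpace ℝ (Fin m) × EuclideanSpace ℝ (Fin m)}
    (h : IsAADMM f g M γ δ s) :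
    IsIteration α β γ δ f g (actCLM M) (fun k => (s k).1) (fun k => (s k).2.1)
      (fun k => (s k).2.2) := by
  refine ⟨fun k => ?_, fun k => ?_, fun k => (h k).2.2⟩
  · refine IsArgmin.isSubgradient (γ := γ) (A := actCLM M) (b := -(s k).2.1 + γ⁻¹ • (s k).2.2)
      hf hfc ?_ fun d => ?_
    · have e : ∀ v, act M v - (s k).2.1 + γ⁻¹ • (s k).2.2 =
          actCLM M v + (-(s k).2.1 + γ⁻¹ • (s k).2.2) := fun v => by
        rw [← add_assoc, ← sub_eq_add_neg]; rfl
      simpa only [e] using (h k).1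
    · have e : (s k).2.2 + γ • (actCLM M (s (k + 1)).1 - (s k).2.1) =
          γ • (actCLM M (s (k + 1)).1 + (-(s k).2.1 + γ⁻¹ • (s k).2.2)) := by
        rw [smul_add, smul_add, smul_inv_smul₀ hγ]; module
      rw [e, inner_neg_left, ContinuousLinearMap.adjoint_inner_left, real_inner_smul_left]
  · refine IsArgmin.isSubgradient (γ := δ) (A := -ContinuousLinearMap.id ℝ _)
      (b := act M (s (k + 1)).1 + δ⁻¹ • (s k).2.2) hg hgc ?_ fun d => ?_
    · have e : ∀ v, act M (s (k + 1)).1 - v + δ⁻¹ • (s k).2.2 =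
          (-ContinuousLinearMap.id ℝ (EuclideanSpace ℝ (Fin m))) v
            + (act M (s (k + 1)).1 + δ⁻¹ • (s k).2.2) := fun v => by
        simp only [neg_apply, ContinuousLinearMap.id_apply]; abel
      simpa only [e] using (h k).2.1
    · have e : (s (k + 1)).2.2 =
          δ • (-(s (k + 1)).2.1 + (act M (s (k + 1)).1 + δ⁻¹ • (s k).2.2)) := by
        rw [(h k).2.2, smul_add, smul_add, smul_inv_smul₀ hδ]; module
      simp only [neg_apply, ContinuousLinearMap.id_apply, inner_neg_right,
        mul_neg, neg_neg]
      rw [← real_inner_smul_left, ← e]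

theorem existsUnique_isAADMM (hf : IsProper f) (hfl : LowerSemicontinuous f)
    (hfc : IsAlphaConvex α f) (hg : IsProper g) (hgl : LowerSemicontinuous g)
    (hgc : IsAlphaConvex β g) {κ : ℝ} (hκ0 : 0 < κ)
    (hκ : ∀ d, κ * ‖d‖ ^ 2 ≤ α * ‖d‖ ^ 2 + γ * ‖actCLM M d‖ ^ 2) (hδβ : 0 < β + δ)
    (s₀ : EuclideanSpace ℝ (Fin n) × EuclideanSpace ℝ (Fin m) × EuclideanSpace ℝ (Fin m)) :
    ∃! s : ℕ → EuclideanSpace ℝ (Fin n) × EuclideanSpace ℝ (Fin m) × EuclideanSpace ℝ (Fin m),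
      s 0 = s₀ ∧ IsAADMM f g M γ δ s := by
  have hx : ∀ z y : EuclideanSpace ℝ (Fin m), ∃! x, IsArgmin
      (fun x => f x + ((γ / 2 * ‖act M x - z + γ⁻¹ • y‖ ^ 2 : ℝ) : EReal)) x := by
    intro z y
    have e : ∀ v, act M v - z + γ⁻¹ • y = actCLM M v + (-z + γ⁻¹ • y) := fun v => by
      rw [← add_assoc, ← sub_eq_add_neg]; rfl
    simp only [e]
    exact existsUnique_isArgmin_add_quadratic hf hfl hfc (actCLM M) _ hκ0 hκ
  have hz : ∀ (x : EuclideanSpace ℝ (Fin n)) (y : EuclideanSpace ℝ (Fin m)), ∃! z, IsArgmin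
      (fun z => g z + ((δ / 2 * ‖act M x - z + δ⁻¹ • y‖ ^ 2 : ℝ) : EReal)) z := by
    intro x y
    have e : ∀ v, act M x - v + δ⁻¹ • y =
        (-ContinuousLinearMap.id ℝ (EuclideanSpace ℝ (Fin m))) v + (act M x + δ⁻¹ • y) :=
      fun v => by
        simp only [neg_apply, ContinuousLinearMap.id_apply]; abel
    simp only [e]
    refine existsUnique_isArgmin_add_quadratic hg hgl hgc _ _ hδβ fun d => ?_
    simp only [neg_apply, ContinuousLinearMap.id_apply, norm_neg]
    linarith
  choose X hX hXu using hx
  choose Z hZ hZu using hz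
  set step : EuclideanSpace ℝ (Fin n) × EuclideanSpace ℝ (Fin m) × EuclideanSpace ℝ (Fin m) →
      EuclideanSpace ℝ (Fin n) × EuclideanSpace ℝ (Fin m) × EuclideanSpace ℝ (Fin m) :=
    fun p =>
      let x := X p.2.1 p.2.2
      let z := Z x p.2.2
      (x, z, p.2.2 + δ • (act M x - z)) with hstep
  refine ⟨fun k => step^[k] s₀, ⟨rfl, fun k => ?_⟩, ?_⟩
  · simp only [Function.iterate_succ_apply']
    exact ⟨hX _ _, hZ _ _, rfl⟩
  · rintro s ⟨hs0, hs⟩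
    funext k
    induction k with
    | zero => exact hs0
    | succ k ih =>
      rw [Function.iterate_succ_apply', ← ih]
      obtain ⟨h1, h2, h3⟩ := hs k
      have e1 := hXu _ _ _ h1
      have e2 := hZu _ _ _ h2
      refine Prod.ext e1 (Prod.ext ?_ ?_)
      · rw [e2, e1]
      · rw [h3, e2, e1]

end Problem

end AADMM

theorem mainTheorem2 {m n : ℕ}
    (M : Matrix (Fin m) (Fin n) ℝ) (hM : M ≠ 0)
    (f : EuclideanSpace ℝ (Fin n) → EReal) (g : EuclideanSpace ℝ (Fin m) → EReal)
    (α β : ℝ)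
    (hf_proper : AADMM.IsProper f) (hf_lsc : LowerSemicontinuous f)
    (hf_conv : AADMM.IsAlphaConvex α f)
    (hg_proper : AADMM.IsProper g) (hg_lsc : LowerSemicontinuous g)
    (hg_conv : AADMM.IsAlphaConvex β g)
    (hα : 0 ≤ α) (hαβ : 0 ≤ α + β * ‖M‖ ^ 2)
    (hcrit : ∃ x z y, AADMM.IsCriticalPoint f g M x z y)
    (hstrong : 0 < α ∨ IsUnit (Mᵀ * M))
    (γ δ : ℝ) (hδ : max 0 (-2 * β) < δ) (hγ : 0 < γ)
    (hγ_eq : α + β * ‖M‖ ^ 2 = 0 → γ = δ + 2 * β)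
    (hγ_mem : 0 < α + β * ‖M‖ ^ 2 →
      γ ∈ Set.Ioo (max 0 (δ + 2 * β - AADMM.paramRadius α β ‖M‖ δ))
        (δ + 2 * β + AADMM.paramRadius α β ‖M‖ δ))
    (x₀ : EuclideanSpace ℝ (Fin n)) (z₀ y₀ : EuclideanSpace ℝ (Fin m)) :
    (∃! s : ℕ → EuclideanSpace ℝ (Fin n) × EuclideanSpace ℝ (Fin m) × EuclideanSpace ℝ (Fin m),
      s 0 = (x₀, z₀, y₀) ∧ AADMM.IsAADMM f g M γ δ s) ∧
    ∀ s : ℕ → EuclideanSpace ℝ (Fin n) × EuclideanSpace ℝ (Fin m) × EuclideanSpace ℝ (Fin m),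
      s 0 = (x₀, z₀, y₀) → AADMM.IsAADMM f g M γ δ s →
      ∃ (x : EuclideanSpace ℝ (Fin n)) (z y : EuclideanSpace ℝ (Fin m)),
        Tendsto (fun k => (s k).1) atTop (𝓝 x) ∧
        Tendsto (fun k => (s k).2.1) atTop (𝓝 z) ∧
        Tendsto (fun k => (s k).2.2) atTop (𝓝 y) ∧
        AADMM.IsCriticalPoint f g M x z y ∧
        AADMM.IsSolution f g M x z := by
  obtain ⟨hδ0, hδβ⟩ := max_lt_iff.1 hδ
  have hM0 : 0 < ‖M‖ := norm_pos_iff.2 hM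
  have hc : 0 < 2 * β + δ := by linarith
  have hβδ : 0 < β + δ := by linarith
  obtain ⟨κ, hκ0, hκ⟩ := AADMM.exists_pos_mul_norm_sq_le hα hstrong
  -- `α'` is the modulus of monotonicity seen through `M`.
  obtain ⟨α', hα'⟩ : ∃ α', α' = α / ‖M‖ ^ 2 := ⟨_, rfl⟩
  have hα'M : α + β * ‖M‖ ^ 2 = (α' + β) * ‖M‖ ^ 2 := by rw [hα']; field_simp
  have hα'_le : ∀ d, α' * ‖AADMM.actCLM M d‖ ^ 2 ≤ α * ‖d‖ ^ 2 := by
    intro d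
    have h1 : ‖AADMM.actCLM M d‖ ^ 2 ≤ ‖M‖ ^ 2 * ‖d‖ ^ 2 := by
      rw [← mul_pow]
      gcongr
      exact AADMM.norm_act_le M d
    rw [hα', div_mul_eq_mul_div, div_le_iff₀ (by positivity)]
    nlinarith
  have hsum : 0 ≤ α' + β := by
    rw [hα'M] at hαβ
    exact nonneg_of_mul_nonneg_left hαβ (by positivity)
  -- The range allowed for `γ` is exactly positivity of the form that drives Fejér monotonicity.
  have hquad : γ ^ 2 < (2 * α' + 2 * γ - δ) * (2 * β + δ) ∨
      (2 * α' + 2 * γ - δ = γ ∧ 2 * β + δ = γ) := by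
    rcases hαβ.eq_or_lt with h0 | h0
    · right
      have h1 := hγ_eq h0.symm
      have h2 : α' + β = 0 := by
        rw [hα'M] at h0
        rcases mul_eq_zero.1 h0.symm with h | h
        · exact h
        · exact absurd h (by positivity)
      constructor <;> linarith
    · left
      obtain ⟨h1, h2⟩ := hγ_mem h0
      have h3 := (max_lt_iff.1 h1).2
      have h4 : (γ - (δ + 2 * β)) ^ 2 < AADMM.paramRadius α β ‖M‖ δ ^ 2 :=
        sq_lt_sq' (by linarith) (by linarith)
      have h5 : AADMM.paramRadius α β ‖M‖ δ ^ 2 = 2 * (α' + β) * (δ + 2 * β) := by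
        have h6 : 0 ≤ 2 * (α + β * ‖M‖ ^ 2) * (δ + 2 * β) :=
          mul_nonneg (by linarith) (by linarith)
        rw [AADMM.paramRadius, mul_pow, Real.sq_sqrt h6, hα'M]
        field_simp
      rw [h5] at h4
      nlinarith
  obtain ⟨ε, hε0, hε⟩ :=
    AADMM.exists_pos_mul_norm_sub_sq_le (F := EuclideanSpace ℝ (Fin m)) hc hquad
  have hkkt := fun {x z y} => AADMM.isCriticalPoint_iff_isKKT (M := M) (x := x) (z := z) (y := y)
    hf_proper hf_conv hα hg_proper hg_conv
  refine ⟨?_, fun s _ hs => ?_⟩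
  · refine AADMM.existsUnique_isAADMM (κ := min 1 γ * κ) hf_proper hf_lsc hf_conv hg_proper
      hg_lsc hg_conv (mul_pos (lt_min one_pos hγ) hκ0) (fun d => ?_) hβδ (x₀, z₀, y₀)
    calc min 1 γ * κ * ‖d‖ ^ 2 = min 1 γ * (κ * ‖d‖ ^ 2) := by ring
      _ ≤ min 1 γ * (α * ‖d‖ ^ 2 + ‖AADMM.actCLM M d‖ ^ 2) := by
        gcongr
        exact hκ d
      _ = min 1 γ * (α * ‖d‖ ^ 2) + min 1 γ * ‖AADMM.actCLM M d‖ ^ 2 := by ring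
      _ ≤ 1 * (α * ‖d‖ ^ 2) + γ * ‖AADMM.actCLM M d‖ ^ 2 := by
        gcongr
        · exact min_le_left _ _
        · exact min_le_right _ _
      _ = α * ‖d‖ ^ 2 + γ * ‖AADMM.actCLM M d‖ ^ 2 := by ring
  · obtain ⟨xs, zs, ys, hcr⟩ := hcrit
    obtain ⟨x, z, y, hx, hz, hy, h⟩ := (hs.isIteration hf_proper hf_conv hg_proper hg_conv
      hγ.ne' hδ0.ne').exists_tendsto hf_proper hf_lsc hg_proper hg_lsc
      ⟨xs, zs, ys, hkkt.1 hcr⟩ hδ0 (by linarith) hα'_le hε0 hε hκ0 hκ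
    exact ⟨x, z, y, hx, hz, hy, hkkt.2 h, h.isSolution hf_proper hg_proper hα'_le hsum⟩
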